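/- Let $\rho>0$, $\beta>0$ and $x_0>0$ be real constants, and let $W$ be a standard Brownian motion with $W(0)=0$. For every $n\ge 1$ let $\sigma_n>0$ and $\tau_n>0$ satisfy $\tfrac12\sigma_n^2\tau_n n^2=\beta$, and define $x^{(n)}_0=x_0$ and $$x^{(n)}_{i+1}=a^{(n)}_i\,x^{(n)}_i,\qquad a^{(n)}_i=1+\rho\, e^{\sigma_n W(t^{(n)}_i)-\frac12\sigma_n^2 t^{(n)}_i},\qquad t^{(n)}_i=i\,\tau_n ,\qquad i\ge 0 .$$ Then $\mathbb{E}[x^{(n)}_n]<\infty$ for every $n$, the limit $$\lambda(\rho,\beta)=\lim_{n\to\infty}\frac1n\log\mathbb{E}\big[x^{(n)}_n\big]$$ exists in $\mathbb{R}$, and $$\lambda(\rho,\beta)=\sup_{g\in\mathcal{G}}\left\{g(1)\log\rho+\beta\int_0^1\big(g(1)-g(x)\big)^2dx-\int_0^1 I\big(g'(x)\big)\,dx\right\},$$ where $I(x)=x\log x+(1-x)\log(1-x)$ for $x\in[0,1]$ (with $0\log 0=0$) and $\mathcal{G}$ is the set of absolutely continuous functions $g:[0,1]\to[0,1]$ with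 $g(0)=0$ and $0\le g'\le 1$ almost everywhere. In particular the limit depends only on $\rho$ and $\beta$. -/

import Mathlib

open MeasureTheory ProbabilityTheory Filter Topology Set
open scoped NNReal

namespace LinearRecursion

variable {Ω : Type*}

/-- The multiplier `a_i = 1 + ρ exp (σ W_i - σ² t_i / 2)`, where `t_i = i τ` and `W_i = W (t_i)`. -/
noncomputable def multiplier (ρ σ : ℝ) (τ : ℝ≥0) (W : ℝ≥0 → Ω → ℝ) (i : ℕ) (ω : Ω) : ℝ :=
  1 + ρ * Real.exp (σ * W ((i : ℝ≥0) * τ) ω - σ ^ 2 * ((i : ℝ) * (τ : ℝ)) / 2)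

/-- The multiplicative process `x_{i+1} = a_i x_i` started at the constant `x₀`. -/
noncomputable def process (x₀ ρ σ : ℝ) (τ : ℝ≥0) (W : ℝ≥0 → Ω → ℝ) : ℕ → Ω → ℝ
  | 0, _ => x₀
  | i + 1, ω => multiplier ρ σ τ W i ω * process x₀ ρ σ τ W i ω

/-- `I(x) = x log x + (1 - x) log (1 - x)`, with the convention `0 log 0 = 0`
(which holds since `Real.log 0 = 0`). -/
noncomputable def entropyFn (x : ℝ) : ℝ :=
  x * Real.log x + (1 - x) * Real.log (1 - x)

/-- The set of admissible paths: absolutely continuous `g : [0,1] → [0,1]` with `g(0) = 0` and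
`0 ≤ g' ≤ 1` almost everywhere. A path is represented by a function on `ℝ`, of which only the
values on `[0,1]` matter. -/
def admissiblePaths : Set (ℝ → ℝ) :=
  {g | MapsTo g (Icc 0 1) (Icc 0 1) ∧ g 0 = 0 ∧ AbsolutelyContinuousOnInterval g 0 1 ∧
    ∀ᵐ x ∂(volume.restrict (Icc (0 : ℝ) 1)), 0 ≤ deriv g x ∧ deriv g x ≤ 1}

/-- The functional
`g ↦ g(1) log ρ + β ∫₀¹ (g(1) - g(x))² dx - ∫₀¹ I(g'(x)) dx`. -/
noncomputable def pathFunctional (ρ β : ℝ) (g : ℝ → ℝ) : ℝ :=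
  Real.log ρ * g 1 + β * (∫ x in (0 : ℝ)..1, (g 1 - g x) ^ 2)
    - ∫ x in (0 : ℝ)..1, entropyFn (deriv g x)

end LinearRecursion

/-! Expand the product over subsets S of `range n`. The covariance of W at times iτ and jτ is τ
min(i, j), and min(i, j) counts the k below both, so the mean is x₀ ∑_S ρ^|S| exp(b(∑_k T_k(S)² -
∑_{i∈S} i)), with b = β/n² and T_k(S) the number of elements of S above k. The term ∑ i changes this
by a factor between e^{-β} and 1, which leaves a mean-field partition function.

Both bounds on it use T² = max_a (2aT - a²). For a fixed profile a the weight factorises over sites,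
the sum is ∏(1 + e^{h_i}), and log(1 + e^h) = max_p (ph - I(p)). A single profile gives the lower
bound (`exp_discreteFunctional_le_partitionSum`). For the upper bound, exp(O(√n log n))
block-constant profiles serve all S with bounded error in the exponent (`partitionSum_le`).

The discrete variational problem is n times the continuous one up to O(1): Jensen passes from paths
to slopes (`mul_pathFunctional_le`), and step functions pass back
(`exists_admissiblePath_discreteFunctional_le`). -/

namespace LinearRecursion

/-! ### Tail sums and the subset expansion -/

/-- The sum of `q i` over those `i ∈ s` that are larger than `k`. -/
def tailSum (s : Finset ℕ) (q : ℕ → ℝ) (k : ℕ) : ℝ := ∑ i ∈ s with k < i, q i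

theorem sum_mul_tailSum {n : ℕ} {s : Finset ℕ} (hs : s ⊆ Finset.range n) (a q : ℕ → ℝ) :
    ∑ k ∈ Finset.range n, a k * tailSum s q k = ∑ i ∈ s, q i * ∑ k ∈ Finset.range i, a k := by
  simp_rw [tailSum, Finset.sum_filter, Finset.mul_sum]
  rw [Finset.sum_comm]
  refine Finset.sum_congr rfl fun i hi => ?_
  have hin : i < n := Finset.mem_range.1 (hs hi)
  have : Finset.range i = (Finset.range n).filter (· < i) := by
    ext k; simp; omega
  rw [this, Finset.sum_filter]
  refine Finset.sum_congr rfl fun k _ => ?_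
  split_ifs <;> ring

/-- min(i, j) is the number of k below both i and j; this turns the Brownian covariance into a sum
of squares. -/
theorem sum_sum_min {n : ℕ} {s : Finset ℕ} (hs : s ⊆ Finset.range n) :
    ∑ i ∈ s, ∑ j ∈ s, ((min i j : ℕ) : ℝ) =
      ∑ k ∈ Finset.range n, tailSum s (fun _ => 1) k ^ 2 := by
  have hk : ∀ k, tailSum s (fun _ => 1) k ^ 2 =
      ∑ i ∈ s, ∑ j ∈ s, if k < i ∧ k < j then (1 : ℝ) else 0 := fun k => by
    simp_rw [tailSum, sq, Finset.sum_filter, Finset.sum_mul_sum]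
    refine Finset.sum_congr rfl fun i _ => Finset.sum_congr rfl fun j _ => ?_
    by_cases h1 : k < i <;> by_cases h2 : k < j <;> simp [h1, h2]
  simp_rw [hk]
  rw [Finset.sum_comm (s := Finset.range n)]
  refine Finset.sum_congr rfl fun i hi => ?_
  rw [Finset.sum_comm]
  refine Finset.sum_congr rfl fun j _ => ?_
  have hin : i < n := Finset.mem_range.1 (hs hi)
  have : (Finset.range n).filter (fun k => k < i ∧ k < j) = Finset.range (min i j) := by
    ext k; simp; omega
  rw [← Finset.sum_filter, this]
  simp

theorem process_eq_sum {Ω : Type*} (x₀ ρ σ : ℝ) (τ : ℝ≥0) (W : ℝ≥0 → Ω → ℝ) (n : ℕ) (ω : Ω) :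
    process x₀ ρ σ τ W n ω = ∑ s ∈ (Finset.range n).powerset,
      x₀ * ρ ^ s.card * Real.exp (-(σ ^ 2 * τ / 2 * ∑ i ∈ s, (i : ℝ))) *
        Real.exp (σ * ∑ i ∈ s, W ((i : ℝ≥0) * τ) ω) := by
  have h : process x₀ ρ σ τ W n ω = x₀ * ∏ i ∈ Finset.range n, multiplier ρ σ τ W i ω := by
    induction n with
    | zero => simp [process]
    | succ n ih => rw [process, ih, Finset.prod_range_succ]; ring
  simp_rw [h, multiplier, Finset.prod_one_add, Finset.mul_sum]
  refine Finset.sum_congr rfl fun s _ => ?_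
  rw [Finset.prod_mul_distrib, Finset.prod_const, ← Real.exp_sum, mul_assoc (x₀ * _), ← Real.exp_add,
    ← mul_assoc, ← Finset.mul_sum, ← Finset.mul_sum, Finset.sum_sub_distrib, Finset.mul_sum,
    Finset.mul_sum, ← Finset.sum_neg_distrib, ← Finset.sum_add_distrib, ← Finset.sum_sub_distrib]
  congr 2
  refine Finset.sum_congr rfl fun i _ => ?_
  ring

/-! ### Gaussian exponential moments and the mean -/

variable {Ω : Type*} [MeasurableSpace Ω] {P : Measure Ω} {W : ℝ≥0 → Ω → ℝ}

theorem map_sum_brownian (hW : IsPreBrownianReal W P) {τ : ℝ≥0} (hτ : 0 < τ)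
    {n : ℕ} {s : Finset ℕ} (hs : s ⊆ Finset.range n) :
    P.map (fun ω => ∑ i ∈ s, W ((i : ℝ≥0) * τ) ω) = gaussianReal 0
      (τ * ∑ k ∈ Finset.range n, tailSum s (fun _ => 1) k ^ 2 : ℝ).toNNReal := by
  have : IsProbabilityMeasure P := hW.isGaussianProcess.isProbabilityMeasure
  -- Since τ > 0, the times iτ are distinct, so the sum over s is a sum over a finite set of times.
  have hinj : Function.Injective fun i : ℕ => (i : ℝ≥0) * τ := fun i j h => by
    simpa using mul_right_cancel₀ hτ.ne' h
  have hlaw : HasGaussianLaw (fun ω => ∑ i ∈ s, W ((i : ℝ≥0) * τ) ω) P := by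
    have := hW.isGaussianProcess.hasGaussianLaw_fun_sum
      (I := s.map ⟨fun i : ℕ => (i : ℝ≥0) * τ, hinj⟩)
    simpa using this
  have hmem : ∀ i ∈ s, MemLp (W ((i : ℝ≥0) * τ)) 2 P := fun i _ =>
    (hW.isGaussianProcess.hasGaussianLaw_eval _).memLp_two
  rw [hlaw.map_eq_gaussianReal]
  congr 1
  · rw [integral_finsetSum _ fun i _ => hW.integrable_eval _]
    exact Finset.sum_eq_zero fun i _ => hW.integral_eval _
  · congr 1
    rw [variance_fun_sum' hmem, ← sum_sum_min hs, Finset.mul_sum]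
    refine Finset.sum_congr rfl fun i _ => ?_
    rw [Finset.mul_sum]
    refine Finset.sum_congr rfl fun j _ => ?_
    rw [hW.covariance_eval, ← min_mul_of_nonneg _ _ hτ.le]
    push_cast
    ring

theorem integrable_exp_sum_brownian (hW : IsPreBrownianReal W P) {τ : ℝ≥0} (hτ : 0 < τ) (σ : ℝ)
    {n : ℕ} {s : Finset ℕ} (hs : s ⊆ Finset.range n) :
    Integrable (fun ω => Real.exp (σ * ∑ i ∈ s, W ((i : ℝ≥0) * τ) ω)) P ∧
    ∫ ω, Real.exp (σ * ∑ i ∈ s, W ((i : ℝ≥0) * τ) ω) ∂P =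
      Real.exp (σ ^ 2 * τ / 2 * ∑ k ∈ Finset.range n, tailSum s (fun _ => 1) k ^ 2) := by
  have : IsProbabilityMeasure P := hW.isGaussianProcess.isProbabilityMeasure
  have hmap := map_sum_brownian hW hτ hs
  have hmgf := mgf_gaussianReal hmap σ
  constructor
  -- A non-integrable exponential would have Bochner integral 0, so a positive mgf forces
  -- integrability.
  · have hpos : 0 < mgf (fun ω => ∑ i ∈ s, W ((i : ℝ≥0) * τ) ω) P σ := hmgf ▸ Real.exp_pos _
    exact mgf_pos_iff.1 hpos
  · rw [mgf] at hmgf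
    rw [hmgf, Real.coe_toNNReal _ (by positivity)]
    congr 1
    ring

theorem integrable_process (hW : IsPreBrownianReal W P) (x₀ ρ σ : ℝ) {τ : ℝ≥0} (hτ : 0 < τ)
    (n : ℕ) : Integrable (process x₀ ρ σ τ W n) P := by
  have : process x₀ ρ σ τ W n = _ := funext (process_eq_sum x₀ ρ σ τ W n)
  rw [this]
  exact integrable_finsetSum _ fun s hs =>
    (integrable_exp_sum_brownian hW hτ σ (Finset.mem_powerset.1 hs)).1.const_mul _

theorem integral_process (hW : IsPreBrownianReal W P) (x₀ ρ σ : ℝ) {τ : ℝ≥0} (hτ : 0 < τ)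
    (n : ℕ) : ∫ ω, process x₀ ρ σ τ W n ω ∂P = x₀ * ∑ s ∈ (Finset.range n).powerset,
      ρ ^ s.card * Real.exp (σ ^ 2 * τ / 2 *
        (∑ k ∈ Finset.range n, tailSum s (fun _ => 1) k ^ 2 - ∑ i ∈ s, (i : ℝ))) := by
  simp_rw [process_eq_sum]
  rw [integral_finsetSum _ fun s hs =>
    (integrable_exp_sum_brownian hW hτ σ (Finset.mem_powerset.1 hs)).1.const_mul _, Finset.mul_sum]
  refine Finset.sum_congr rfl fun s hs => ?_
  rw [integral_const_mul, (integrable_exp_sum_brownian hW hτ σ (Finset.mem_powerset.1 hs)).2,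
    mul_assoc, ← Real.exp_add, mul_assoc]
  congr 3
  ring

/-! ### Binary entropy and its Legendre transform -/

theorem entropyFn_eq_neg_binEntropy (p : ℝ) : entropyFn p = -Real.binEntropy p := by
  rw [entropyFn, Real.binEntropy_eq_negMulLog_add_negMulLog_one_sub, Real.negMulLog, Real.negMulLog]
  ring

theorem continuous_entropyFn : Continuous entropyFn := by
  rw [funext entropyFn_eq_neg_binEntropy]
  exact Real.binEntropy_continuous.neg

theorem convexOn_entropyFn : ConvexOn ℝ (Icc 0 1) entropyFn := by
  rw [funext entropyFn_eq_neg_binEntropy]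
  exact Real.strictConcave_binEntropy.concaveOn.neg

theorem mul_sub_entropyFn_le {p : ℝ} (hp : p ∈ Icc (0 : ℝ) 1) (h : ℝ) :
    p * h - entropyFn p ≤ Real.log (1 + Real.exp h) := by
  obtain ⟨h0, h1⟩ := hp
  rcases h0.eq_or_lt with rfl | h0
  · simpa [entropyFn] using Real.log_nonneg (by linarith [Real.exp_pos h])
  rcases h1.eq_or_lt with rfl | h1
  · have := Real.log_le_log (Real.exp_pos h) (by linarith : Real.exp h ≤ 1 + Real.exp h)
    simpa [entropyFn] using this
  -- Jensen for log at e^h/p and 1/(1-p), with weights p and 1-p, whose mean is e^h + 1.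
  have hc := strictConcaveOn_log_Ioi.concaveOn.2
    (show Real.exp h / p ∈ Ioi 0 from div_pos (Real.exp_pos h) h0)
    (show (1 / (1 - p)) ∈ Ioi (0 : ℝ) from div_pos one_pos (sub_pos.2 h1)) h0.le
    (by linarith : 0 ≤ 1 - p) (by ring)
  have h1' : 1 - p ≠ 0 := (sub_pos.2 h1).ne'
  rw [smul_eq_mul, smul_eq_mul, smul_eq_mul, smul_eq_mul, mul_div_cancel₀ _ h0.ne',
    mul_div_cancel₀ _ h1', Real.log_div (Real.exp_pos h).ne' h0.ne', Real.log_div one_ne_zero h1',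
    Real.log_exp, Real.log_one] at hc
  rw [entropyFn, add_comm 1]
  linarith

theorem exists_mul_sub_entropyFn_eq (h : ℝ) :
    ∃ p ∈ Icc (0 : ℝ) 1, p * h - entropyFn p = Real.log (1 + Real.exp h) := by
  have he := Real.exp_pos h
  have hs : 0 < 1 + Real.exp h := by positivity
  refine ⟨Real.exp h / (1 + Real.exp h), ⟨by positivity, (div_le_one hs).2 (by linarith)⟩, ?_⟩
  have h2 : 1 - Real.exp h / (1 + Real.exp h) = 1 / (1 + Real.exp h) := by
    field_simp; ring
  rw [entropyFn, h2, Real.log_div he.ne' hs.ne', Real.log_div one_ne_zero hs.ne', Real.log_exp,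
    Real.log_one]
  field_simp
  ring

/-! ### Linearisation of the partition function -/

/-- The partition function `∑_S ρ^|S| exp (b ∑_k T_k(S)²)` over the subsets `S` of `range n`,
where `T_k(S)` is the number of elements of `S` above `k`. -/
noncomputable def partitionSum (ρ b : ℝ) (n : ℕ) : ℝ :=
  ∑ s ∈ (Finset.range n).powerset,
    ρ ^ s.card * Real.exp (b * ∑ k ∈ Finset.range n, tailSum s (fun _ => 1) k ^ 2)

/-- The finite-dimensional analogue of `pathFunctional`. -/
noncomputable def discreteFunctional (ρ b : ℝ) (n : ℕ) (p : ℕ → ℝ) : ℝ :=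
  Real.log ρ * ∑ i ∈ Finset.range n, p i
    + b * ∑ k ∈ Finset.range n, tailSum (Finset.range n) p k ^ 2
    - ∑ i ∈ Finset.range n, entropyFn (p i)

/-- The local field in direction `i` after linearising `∑ T_k²` around `a`. -/
noncomputable def field (ρ b : ℝ) (a : ℕ → ℝ) (i : ℕ) : ℝ :=
  Real.log ρ + 2 * b * ∑ k ∈ Finset.range i, a k

variable {ρ b : ℝ}

/-- The exponent is now affine in the indicator of S, so the subset sum factorises into ∏(1 +
e^{h_i}). -/
theorem sum_linearized_weight (hρ : 0 < ρ) (n : ℕ) (a : ℕ → ℝ) :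
    ∑ s ∈ (Finset.range n).powerset, ρ ^ s.card *
      Real.exp (b * ∑ k ∈ Finset.range n, (2 * a k * tailSum s (fun _ => 1) k - a k ^ 2)) =
    Real.exp (∑ i ∈ Finset.range n, Real.log (1 + Real.exp (field ρ b a i))
      - b * ∑ k ∈ Finset.range n, a k ^ 2) := by
  rw [Real.exp_sub, Real.exp_sum, Finset.prod_congr rfl fun i _ =>
    Real.exp_log (by positivity : 0 < 1 + Real.exp (field ρ b a i)), Finset.prod_one_add,
    Finset.sum_div]
  refine Finset.sum_congr rfl fun s hs => ?_
  rw [eq_div_iff (Real.exp_pos _).ne', mul_assoc, ← Real.exp_sum]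
  simp_rw [field]
  rw [Finset.sum_add_distrib, Finset.sum_const, Real.exp_add, nsmul_eq_mul, Real.exp_nat_mul,
    Real.exp_log hρ, ← Real.exp_add, Finset.sum_sub_distrib]
  congr 2
  have := sum_mul_tailSum (Finset.mem_powerset.1 hs) a (fun _ => 1)
  simp only [one_mul] at this
  rw [← Finset.mul_sum, ← this]
  simp_rw [mul_assoc, ← Finset.mul_sum]
  ring

theorem sum_mul_field (n : ℕ) (a p : ℕ → ℝ) :
    ∑ i ∈ Finset.range n, p i * field ρ b a i = Real.log ρ * ∑ i ∈ Finset.range n, p i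
      + b * ∑ k ∈ Finset.range n, 2 * a k * tailSum (Finset.range n) p k := by
  have := sum_mul_tailSum (Finset.Subset.refl (Finset.range n)) a p
  simp_rw [mul_assoc, ← Finset.mul_sum]
  rw [this, Finset.mul_sum, Finset.mul_sum, Finset.mul_sum, ← Finset.sum_add_distrib]
  refine Finset.sum_congr rfl fun i _ => ?_
  rw [field]
  ring

/-- Linearise at the tail sums of p itself: T² ≥ 2aT - a² bounds the partition sum below, and
entropy duality compares each factor with p i. -/
theorem exp_discreteFunctional_le_partitionSum (hρ : 0 < ρ) (hb : 0 ≤ b) (n : ℕ) {p : ℕ → ℝ}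
    (hp : ∀ i < n, p i ∈ Icc (0 : ℝ) 1) :
    Real.exp (discreteFunctional ρ b n p) ≤ partitionSum ρ b n := by
  set a := tailSum (Finset.range n) p with ha
  calc Real.exp (discreteFunctional ρ b n p)
      ≤ Real.exp (∑ i ∈ Finset.range n, Real.log (1 + Real.exp (field ρ b a i))
          - b * ∑ k ∈ Finset.range n, a k ^ 2) := by
        rw [Real.exp_le_exp]
        have h1 := Finset.sum_le_sum fun i hi =>
          mul_sub_entropyFn_le (hp i (Finset.mem_range.1 hi)) (field ρ b a i)
        rw [Finset.sum_sub_distrib, sum_mul_field] at h1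
        have h2 : ∑ k ∈ Finset.range n, 2 * a k * a k = 2 * ∑ k ∈ Finset.range n, a k ^ 2 := by
          rw [Finset.mul_sum]
          exact Finset.sum_congr rfl fun k _ => by ring
        rw [← ha, h2] at h1
        rw [discreteFunctional, ← ha]
        linarith
    _ ≤ partitionSum ρ b n := by
        rw [← sum_linearized_weight hρ, partitionSum]
        gcongr with s hs k hk
        nlinarith [sq_nonneg (a k - tailSum s (fun _ => 1) k)]

/-- Take p i optimal in the entropy duality for the field of a; then 2aT ≤ a² + T² removes a. -/
theorem exists_linearized_le_discreteFunctional (hb : 0 ≤ b) (n : ℕ) (a : ℕ → ℝ) :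
    ∃ p : ℕ → ℝ, (∀ i, p i ∈ Icc (0 : ℝ) 1) ∧
      ∑ i ∈ Finset.range n, Real.log (1 + Real.exp (field ρ b a i))
        - b * ∑ k ∈ Finset.range n, a k ^ 2 ≤ discreteFunctional ρ b n p := by
  choose p hp hpe using fun i => exists_mul_sub_entropyFn_eq (field ρ b a i)
  refine ⟨p, hp, ?_⟩
  rw [← Finset.sum_congr rfl fun i _ => hpe i, Finset.sum_sub_distrib, sum_mul_field,
    discreteFunctional]
  have : b * ∑ k ∈ Finset.range n, 2 * a k * tailSum (Finset.range n) p k ≤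
      b * ∑ k ∈ Finset.range n, a k ^ 2
        + b * ∑ k ∈ Finset.range n, tailSum (Finset.range n) p k ^ 2 := by
    rw [← mul_add, ← Finset.sum_add_distrib]
    gcongr with k hk
    nlinarith [sq_nonneg (a k - tailSum (Finset.range n) p k)]
  linarith

theorem tailSum_one (s : Finset ℕ) (k : ℕ) :
    tailSum s (fun _ => 1) k = (s.filter (k < ·)).card := by
  simp [tailSum]

theorem card_filter_lt_sub_le (s : Finset ℕ) {L : ℕ} (hL : 0 < L) (k : ℕ) :
    (s.filter (k < ·)).card ≤ (s.filter (L * (k / L) < ·)).card ∧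
    (s.filter (L * (k / L) < ·)).card ≤ (s.filter (k < ·)).card + L := by
  have hk : L * (k / L) ≤ k := Nat.mul_div_le k L
  constructor
  · refine Finset.card_le_card fun i hi => ?_
    simp only [Finset.mem_filter] at hi ⊢
    exact ⟨hi.1, by omega⟩
  · have hsub : s.filter (L * (k / L) < ·) ⊆
        s.filter (k < ·) ∪ Finset.Ioc (L * (k / L)) k := fun i hi => by
      simp only [Finset.mem_union, Finset.mem_filter, Finset.mem_Ioc] at hi ⊢
      exact (lt_or_ge k i).imp (⟨hi.1, ·⟩) (⟨hi.2, ·⟩)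
    refine (Finset.card_le_card hsub).trans ((Finset.card_union_le _ _).trans ?_)
    have := Nat.mod_add_div k L
    have := Nat.mod_lt k hL
    rw [Nat.card_Ioc]
    omega

/-- Rounding k down to a multiple of L moves T_k by at most L, and T² = 2aT - a² + (a - T)². Hence
each S is served by one of (n+1)^m block-constant profiles, at a cost of bL² per site. -/
theorem partitionSum_le (hρ : 0 < ρ) (hb : 0 ≤ b) {n m L : ℕ} (hL : 0 < L) (hm : ∀ k < n, k / L < m)
    {M : ℝ} (hM : ∀ p : ℕ → ℝ, (∀ i, p i ∈ Icc (0 : ℝ) 1) → discreteFunctional ρ b n p ≤ M) :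
    partitionSum ρ b n ≤ ((n : ℝ) + 1) ^ m * Real.exp (b * (n * (L : ℝ) ^ 2)) * Real.exp M := by
  let A : (Fin m → Fin (n + 1)) → ℕ → ℝ := fun c k =>
    -- For k < n the default 0 is excluded by `hm`.
    if h : k / L < m then ((c ⟨k / L, h⟩ : ℕ) : ℝ) else 0
  let w : Finset ℕ → (ℕ → ℝ) → ℝ := fun s a => ρ ^ s.card *
    Real.exp (b * ∑ k ∈ Finset.range n, (2 * a k * tailSum s (fun _ => 1) k - a k ^ 2))
  have hw : ∀ s a, 0 ≤ w s a := fun s a => by positivity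
  have hcover : ∀ s ∈ (Finset.range n).powerset,
      ρ ^ s.card * Real.exp (b * ∑ k ∈ Finset.range n, tailSum s (fun _ => 1) k ^ 2) ≤
        Real.exp (b * (n * (L : ℝ) ^ 2)) * ∑ c, w s (A c) := by
    intro s hs
    let c : Fin m → Fin (n + 1) := fun j => ⟨(s.filter (L * j < ·)).card, by
      have h1 := Finset.card_le_card (Finset.filter_subset (L * (j : ℕ) < ·) s)
      have h2 := Finset.card_le_card (Finset.mem_powerset.1 hs)
      rw [Finset.card_range] at h2
      omega⟩
    refine le_trans ?_ (mul_le_mul_of_nonneg_left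
      (Finset.single_le_sum (f := fun c => w s (A c)) (fun c _ => hw s (A c)) (Finset.mem_univ c))
      (Real.exp_pos _).le)
    simp only [w]
    rw [mul_left_comm, ← Real.exp_add, ← mul_add]
    have hconst : (n : ℝ) * (L : ℝ) ^ 2 = ∑ _k ∈ Finset.range n, (L : ℝ) ^ 2 := by simp
    rw [hconst, ← Finset.sum_add_distrib]
    gcongr with k hk
    have hkm := hm k (Finset.mem_range.1 hk)
    have hA : A c k = ((s.filter (L * (k / L) < ·)).card : ℝ) := by simp [A, c, hkm]
    obtain ⟨h1, h2⟩ := card_filter_lt_sub_le s hL k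
    rw [hA, tailSum_one]
    have h1' : ((s.filter (k < ·)).card : ℝ) ≤ (s.filter (L * (k / L) < ·)).card := by
      exact_mod_cast h1
    have h2' : ((s.filter (L * (k / L) < ·)).card : ℝ) ≤ (s.filter (k < ·)).card + L := by
      exact_mod_cast h2
    nlinarith
  have hsum : ∀ a, ∑ s ∈ (Finset.range n).powerset, w s a ≤ Real.exp M := fun a => by
    obtain ⟨p, hp, hpa⟩ := exists_linearized_le_discreteFunctional (ρ := ρ) hb n a
    rw [sum_linearized_weight hρ]
    exact Real.exp_le_exp.2 (hpa.trans (hM p hp))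
  calc partitionSum ρ b n
      ≤ ∑ s ∈ (Finset.range n).powerset, Real.exp (b * (n * (L : ℝ) ^ 2)) * ∑ c, w s (A c) :=
        Finset.sum_le_sum hcover
    _ = Real.exp (b * (n * (L : ℝ) ^ 2)) * ∑ c, ∑ s ∈ (Finset.range n).powerset, w s (A c) := by
        rw [← Finset.mul_sum, Finset.sum_comm]
    _ ≤ Real.exp (b * (n * (L : ℝ) ^ 2)) * ∑ _c : Fin m → Fin (n + 1), Real.exp M := by
        gcongr with c
        exact hsum _
    _ = _ := by
        rw [Finset.sum_const, Finset.card_univ, Fintype.card_fun, Fintype.card_fin,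
          Fintype.card_fin, nsmul_eq_mul]
        push_cast
        ring

/-! ### Discretising admissible paths -/

theorem riemann_sum_bounds {f : ℝ → ℝ} (hf : AntitoneOn f (Icc 0 1)) {n : ℕ} (hn : 0 < n) :
    ∑ k ∈ Finset.range n, f (((k : ℝ) + 1) / n) ≤ n * ∫ x in (0 : ℝ)..1, f x ∧
    n * ∫ x in (0 : ℝ)..1, f x ≤ ∑ k ∈ Finset.range n, f (((k : ℝ) + 1) / n) + (f 0 - f 1) := by
  have hn' : (0 : ℝ) < n := Nat.cast_pos.2 hn
  have hscale : AntitoneOn (fun x : ℝ => f (x / n)) (Icc 0 (0 + (n : ℝ))) := by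
    have hmem : ∀ x ∈ Icc (0 : ℝ) (0 + (n : ℝ)), x / n ∈ Icc (0 : ℝ) 1 := fun x hx =>
      ⟨div_nonneg hx.1 hn'.le, (div_le_one hn').2 (by simpa using hx.2)⟩
    exact fun x hx y hy hxy => hf (hmem x hx) (hmem y hy) (by gcongr)
  have hint : ∫ x in (0 : ℝ)..0 + (n : ℝ), f (x / n) = n * ∫ x in (0 : ℝ)..1, f x := by
    rw [intervalIntegral.integral_comp_div _ hn'.ne', zero_add, zero_div, div_self hn'.ne',
      smul_eq_mul]
  have h1 := hscale.sum_le_integral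
  have h2 := hscale.integral_le_sum
  rw [hint] at h1 h2
  simp only [zero_add, Nat.cast_add, Nat.cast_one] at h1 h2
  have h3 := Finset.sum_range_sub (fun k : ℕ => f ((k : ℝ) / n)) n
  rw [Finset.sum_sub_distrib] at h3
  simp only [Nat.cast_add, Nat.cast_one, Nat.cast_zero, zero_div, div_self hn'.ne'] at h3
  exact ⟨h1, by linarith⟩

/-- The slopes of `g` over the intervals `[i/n, (i+1)/n]`. -/
noncomputable def gridSlope (g : ℝ → ℝ) (n i : ℕ) : ℝ := n * (g (((i : ℝ) + 1) / n) - g ((i : ℝ) / n))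

/-- Tail sums of slopes telescope. The strict inequality k < i is what produces the right endpoint
(k+1)/n. -/
theorem discreteFunctional_gridSlope {g : ℝ → ℝ} (hg0 : g 0 = 0) {n : ℕ} (hn : 0 < n) (ρ β : ℝ) :
    discreteFunctional ρ (β / n ^ 2) n (gridSlope g n) = n * (Real.log ρ * g 1)
      + β * ∑ k ∈ Finset.range n, (g 1 - g (((k : ℝ) + 1) / n)) ^ 2
      - ∑ i ∈ Finset.range n, entropyFn (gridSlope g n i) := by
  have hn' : (n : ℝ) ≠ 0 := Nat.cast_ne_zero.2 hn.ne'
  have hIco : ∀ k ≤ n, ∑ i ∈ Finset.Ico k n, gridSlope g n i = n * (g 1 - g ((k : ℝ) / n)) := by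
    intro k hk
    have := Finset.sum_Ico_sub (fun i : ℕ => g ((i : ℝ) / n)) hk
    simp only [Nat.cast_add, Nat.cast_one, div_self hn'] at this
    simp only [gridSlope]
    rw [← Finset.mul_sum, this]
  have htot : ∑ i ∈ Finset.range n, gridSlope g n i = n * g 1 := by
    rw [Finset.range_eq_Ico, hIco 0 (Nat.zero_le n)]
    simp [hg0]
  have htail : ∀ k ∈ Finset.range n, tailSum (Finset.range n) (gridSlope g n) k ^ 2 =
      (n : ℝ) ^ 2 * (g 1 - g (((k : ℝ) + 1) / n)) ^ 2 := by
    intro k hk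
    have hfilter : (Finset.range n).filter (k < ·) = Finset.Ico (k + 1) n := by
      ext i; simp; omega
    rw [tailSum, hfilter, hIco _ (Finset.mem_range.1 hk)]
    push_cast
    ring
  rw [discreteFunctional, htot, Finset.sum_congr rfl htail, ← Finset.mul_sum]
  field_simp

theorem intervalIntegrable_of_mem_Icc {s : ℝ → ℝ} (hs : Measurable s) {u v C : ℝ} (huv : u ≤ v)
    (h : ∀ᵐ x ∂volume.restrict (Icc u v), |s x| ≤ C) : IntervalIntegrable s volume u v := by
  rw [intervalIntegrable_iff_integrableOn_Icc_of_le huv]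
  exact Measure.integrableOn_of_bounded (by simp) hs.aestronglyMeasurable h

theorem abs_entropyFn_le {p : ℝ} (hp : p ∈ Icc (0 : ℝ) 1) : |entropyFn p| ≤ Real.log 2 := by
  rw [entropyFn_eq_neg_binEntropy, abs_neg, abs_of_nonneg (Real.binEntropy_nonneg hp.1 hp.2)]
  exact Real.binEntropy_le_log_two

theorem intervalIntegrable_entropyFn_comp {s : ℝ → ℝ} (hs : Measurable s) {u v : ℝ} (huv : u ≤ v)
    (h : ∀ᵐ x ∂volume.restrict (Icc u v), s x ∈ Icc (0 : ℝ) 1) :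
    IntervalIntegrable (fun x => entropyFn (s x)) volume u v :=
  intervalIntegrable_of_mem_Icc (continuous_entropyFn.measurable.comp hs) huv
    (h.mono fun _ hx => abs_entropyFn_le hx)

theorem entropyFn_average_le {s : ℝ → ℝ} (hs : Measurable s) {u v : ℝ} (huv : u < v)
    (h : ∀ᵐ x ∂volume.restrict (Icc u v), s x ∈ Icc (0 : ℝ) 1) :
    entropyFn ((v - u)⁻¹ * ∫ x in u..v, s x) ≤ (v - u)⁻¹ * ∫ x in u..v, entropyFn (s x) := by
  have h1 : IntervalIntegrable s volume u v := intervalIntegrable_of_mem_Icc hs huv.le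
    (C := 1) (h.mono fun x hx => abs_le.2 ⟨by linarith [hx.1], hx.2⟩)
  have h2 := intervalIntegrable_entropyFn_comp hs huv.le h
  rw [intervalIntegrable_iff_integrableOn_Ioc_of_le huv.le] at h1 h2
  have := convexOn_entropyFn.map_set_average_le (μ := volume) (t := Ioc u v) (f := s)
    continuous_entropyFn.continuousOn isClosed_Icc
    (by simpa using huv) (by simp) (ae_restrict_of_ae_restrict_of_subset Ioc_subset_Icc_self h) h1 h2
  simpa [setAverage_eq, intervalIntegral.integral_of_le huv.le, huv.le] using this

namespace admissiblePaths

variable {g : ℝ → ℝ}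

theorem sub_eq_integral (hg : g ∈ admissiblePaths) {u v : ℝ} (hu : u ∈ Icc (0 : ℝ) 1)
    (hv : v ∈ Icc (0 : ℝ) 1) : g v - g u = ∫ x in u..v, deriv g x := by
  refine ((hg.2.2.1.mono ?_).integral_deriv_eq_sub).symm
  rw [uIcc_of_le zero_le_one]
  exact uIcc_subset_Icc hu hv

theorem deriv_mem (hg : g ∈ admissiblePaths) {u v : ℝ} (hu : 0 ≤ u) (hv : v ≤ 1) :
    ∀ᵐ x ∂volume.restrict (Icc u v), deriv g x ∈ Icc (0 : ℝ) 1 :=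
  ae_restrict_of_ae_restrict_of_subset (Icc_subset_Icc hu hv) hg.2.2.2

theorem monotoneOn (hg : g ∈ admissiblePaths) : MonotoneOn g (Icc 0 1) := by
  intro u hu v hv huv
  rw [← sub_nonneg, sub_eq_integral hg hu hv]
  exact intervalIntegral.integral_nonneg_of_ae_restrict huv
    ((deriv_mem hg hu.1 hv.2).mono fun x hx => hx.1)

theorem sub_le (hg : g ∈ admissiblePaths) {u v : ℝ} (hu : u ∈ Icc (0 : ℝ) 1)
    (hv : v ∈ Icc (0 : ℝ) 1) (huv : u ≤ v) : g v - g u ≤ v - u := by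
  rw [sub_eq_integral hg hu hv]
  have hd := deriv_mem hg hu.1 hv.2
  have := intervalIntegral.integral_mono_ae_restrict (g := fun _ => (1 : ℝ)) huv
    (intervalIntegrable_of_mem_Icc (measurable_deriv g) huv
      (C := 1) (hd.mono fun x hx => abs_le.2 ⟨by linarith [hx.1], hx.2⟩))
    (by simp) (hd.mono fun x hx => hx.2)
  simpa using this

theorem antitoneOn_sq (hg : g ∈ admissiblePaths) :
    AntitoneOn (fun x => (g 1 - g x) ^ 2) (Icc 0 1) := by
  intro u hu v hv huv
  have h1 := monotoneOn hg hu hv huv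
  have h2 := monotoneOn hg hv ⟨zero_le_one, le_rfl⟩ hv.2
  simp only
  gcongr

end admissiblePaths

theorem grid_mem {n i : ℕ} (hi : i < n) :
    (i : ℝ) / n ∈ Icc (0 : ℝ) 1 ∧ ((i : ℝ) + 1) / n ∈ Icc (0 : ℝ) 1 ∧
      (i : ℝ) / n < ((i : ℝ) + 1) / n := by
  have hn : (0 : ℝ) < n := Nat.cast_pos.2 (by omega)
  have hi' : (i : ℝ) + 1 ≤ n := by exact_mod_cast hi
  refine ⟨⟨by positivity, (div_le_one hn).2 (by linarith)⟩,
    ⟨by positivity, (div_le_one hn).2 hi'⟩, ?_⟩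
  gcongr
  linarith

theorem sum_integral_grid {f : ℝ → ℝ} (hf : IntervalIntegrable f volume 0 1) {n : ℕ} (hn : 0 < n) :
    ∑ i ∈ Finset.range n, ∫ x in ((i : ℝ) / n)..(((i : ℝ) + 1) / n), f x =
      ∫ x in (0 : ℝ)..1, f x := by
  have hn' : (n : ℝ) ≠ 0 := Nat.cast_ne_zero.2 hn.ne'
  have := intervalIntegral.sum_integral_adjacent_intervals (f := f) (μ := volume)
    (a := fun i : ℕ => (i : ℝ) / n) (n := n) fun k hk => hf.mono_set (by
      rw [uIcc_of_le zero_le_one]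
      have := grid_mem hk
      exact uIcc_subset_Icc this.1 (by simpa using this.2.1))
  simpa [div_self hn'] using this

theorem gridSlope_mem {g : ℝ → ℝ} (hg : g ∈ admissiblePaths) {n i : ℕ} (hi : i < n) :
    gridSlope g n i ∈ Icc (0 : ℝ) 1 := by
  have hn : (0 : ℝ) < n := Nat.cast_pos.2 (by omega)
  obtain ⟨h1, h2, h3⟩ := grid_mem hi
  refine ⟨mul_nonneg hn.le (sub_nonneg.2 (admissiblePaths.monotoneOn hg h1 h2 h3.le)), ?_⟩
  have := mul_le_mul_of_nonneg_left (admissiblePaths.sub_le hg h1 h2 h3.le) hn.le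
  rw [gridSlope]
  refine this.trans_eq ?_
  field_simp
  ring

/-- By absolute continuity a grid slope is the mean of g' over its cell, so convexity of I gives
Jensen on each cell. -/
theorem sum_entropyFn_gridSlope_le {g : ℝ → ℝ} (hg : g ∈ admissiblePaths) {n : ℕ} (hn : 0 < n) :
    ∑ i ∈ Finset.range n, entropyFn (gridSlope g n i) ≤
      n * ∫ x in (0 : ℝ)..1, entropyFn (deriv g x) := by
  rw [← sum_integral_grid (intervalIntegrable_entropyFn_comp (measurable_deriv g) zero_le_one
    (admissiblePaths.deriv_mem hg le_rfl le_rfl)) hn, Finset.mul_sum]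
  refine Finset.sum_le_sum fun i hi => ?_
  obtain ⟨h1, h2, h3⟩ := grid_mem (Finset.mem_range.1 hi)
  have := entropyFn_average_le (measurable_deriv g) h3 (admissiblePaths.deriv_mem hg h1.1 h2.2)
  have hlen : (((i : ℝ) + 1) / n - (i : ℝ) / n)⁻¹ = n := by
    rw [← sub_div, add_sub_cancel_left, one_div, inv_inv]
  rwa [hlen, ← admissiblePaths.sub_eq_integral hg h1 h2] at this

theorem mul_pathFunctional_le {g : ℝ → ℝ} (hg : g ∈ admissiblePaths) {n : ℕ} (hn : 0 < n) {β : ℝ}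
    (hβ : 0 ≤ β) (ρ : ℝ) :
    n * pathFunctional ρ β g ≤ discreteFunctional ρ (β / n ^ 2) n (gridSlope g n) + β := by
  have h1 := (riemann_sum_bounds (admissiblePaths.antitoneOn_sq hg) hn).2
  have h2 := sum_entropyFn_gridSlope_le hg hn
  have h3 : (g 1 - g 0) ^ 2 - (g 1 - g 1) ^ 2 ≤ 1 := by
    have := hg.1 (show (1 : ℝ) ∈ Icc (0 : ℝ) 1 from ⟨zero_le_one, le_rfl⟩)
    rw [hg.2.1]
    nlinarith [this.1, this.2]
  have h4 := mul_le_mul_of_nonneg_left (h1.trans (add_le_add_right h3 _)) hβ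
  rw [discreteFunctional_gridSlope hg.2.1 hn, pathFunctional]
  nlinarith

/-! ### Building a path from discrete slopes -/

/-- The step function equal to `p i` on `(i/n, (i+1)/n]`. -/
noncomputable def stepSlope (p : ℕ → ℝ) (n : ℕ) (x : ℝ) : ℝ := p (⌈n * x⌉₊ - 1)

theorem measurable_stepSlope (p : ℕ → ℝ) (n : ℕ) : Measurable (stepSlope p n) :=
  (measurable_from_nat (f := fun k => p (k - 1))).comp
    (Nat.measurable_ceil.comp (measurable_const.mul measurable_id))

theorem integral_comp_stepSlope (p : ℕ → ℝ) {n : ℕ} (hn : 0 < n) (F : ℝ → ℝ) (i : ℕ) :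
    ∫ x in ((i : ℝ) / n)..(((i : ℝ) + 1) / n), F (stepSlope p n x) = F (p i) / n := by
  have hn' : (0 : ℝ) < n := Nat.cast_pos.2 hn
  have hle : (i : ℝ) / n ≤ ((i : ℝ) + 1) / n := by gcongr; linarith
  have : ∀ x ∈ uIoc ((i : ℝ) / n) (((i : ℝ) + 1) / n), F (stepSlope p n x) = F (p i) := by
    intro x hx
    rw [uIoc_of_le hle, mem_Ioc, div_lt_iff₀' hn', le_div_iff₀' hn'] at hx
    have hc : ⌈(n : ℝ) * x⌉₊ = i + 1 := by
      rw [Nat.ceil_eq_iff (Nat.succ_ne_zero i)]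
      simpa using hx
    rw [stepSlope, hc, Nat.add_sub_cancel]
  rw [intervalIntegral.integral_congr_ae (ae_of_all _ this), intervalIntegral.integral_const,
    smul_eq_mul, ← sub_div, add_sub_cancel_left]
  ring

/-- The path is the primitive of the step slope. Its entropy term is exact, and right-endpoint sums
of a decreasing function lie below the integral. -/
theorem exists_admissiblePath_discreteFunctional_le {p : ℕ → ℝ} (hp : ∀ i, p i ∈ Icc (0 : ℝ) 1)
    {n : ℕ} (hn : 0 < n) {β : ℝ} (hβ : 0 ≤ β) (ρ : ℝ) :
    ∃ g ∈ admissiblePaths, discreteFunctional ρ (β / n ^ 2) n p ≤ n * pathFunctional ρ β g := by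
  have hn' : (n : ℝ) ≠ 0 := Nat.cast_ne_zero.2 hn.ne'
  have hmeas := measurable_stepSlope p n
  have hmem : ∀ x, stepSlope p n x ∈ Icc (0 : ℝ) 1 := fun x => hp _
  have hint : ∀ u v, u ≤ v → IntervalIntegrable (stepSlope p n) volume u v := fun u v huv =>
    intervalIntegrable_of_mem_Icc hmeas huv (C := 1)
      (ae_of_all _ fun x => abs_le.2 ⟨by linarith [(hmem x).1], (hmem x).2⟩)
  let g : ℝ → ℝ := fun x => ∫ t in (0 : ℝ)..x, stepSlope p n t
  have hderiv : ∀ᵐ x ∂(volume.restrict (Icc (0 : ℝ) 1)), deriv g x = stepSlope p n x := by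
    rw [ae_restrict_iff' measurableSet_Icc]
    filter_upwards [(hint 0 1 zero_le_one).ae_hasDerivAt_integral] with x hx hx01
    rw [uIcc_of_le zero_le_one] at hx
    exact (hx hx01 0 ⟨le_rfl, zero_le_one⟩).deriv
  have hg : g ∈ admissiblePaths := by
    refine ⟨fun x hx => ⟨intervalIntegral.integral_nonneg hx.1 fun t _ => (hmem t).1, ?_⟩,
      intervalIntegral.integral_same,
      (hint 0 1 zero_le_one).absolutelyContinuousOnInterval_intervalIntegral left_mem_uIcc,
      hderiv.mono fun x hx => hx ▸ hmem x⟩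
    have := intervalIntegral.integral_mono_on (g := fun _ => (1 : ℝ)) hx.1 (hint 0 x hx.1)
      (by simp) fun t _ => (hmem t).2
    refine (this.trans_eq ?_).trans hx.2
    simp
  have hslope : ∀ i ∈ Finset.range n, gridSlope g n i = p i := by
    intro i hi
    obtain ⟨h1, h2, h3⟩ := grid_mem (Finset.mem_range.1 hi)
    rw [gridSlope, intervalIntegral.integral_interval_sub_left (hint _ _ h2.1) (hint _ _ h1.1),
      integral_comp_stepSlope p hn (fun y => y)]
    field_simp
  have hent : n * ∫ x in (0 : ℝ)..1, entropyFn (deriv g x) =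
      ∑ i ∈ Finset.range n, entropyFn (p i) := by
    have hcongr : ∫ x in (0 : ℝ)..1, entropyFn (deriv g x) =
        ∫ x in (0 : ℝ)..1, entropyFn (stepSlope p n x) := by
      refine intervalIntegral.integral_congr_ae ?_
      rw [ae_restrict_iff' measurableSet_Icc] at hderiv
      filter_upwards [hderiv] with x hx hx01
      rw [uIoc_of_le zero_le_one] at hx01
      rw [hx (Ioc_subset_Icc_self hx01)]
    rw [hcongr, ← sum_integral_grid (intervalIntegrable_entropyFn_comp hmeas zero_le_one
      (ae_of_all _ hmem)) hn, Finset.mul_sum]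
    refine Finset.sum_congr rfl fun i _ => ?_
    rw [integral_comp_stepSlope p hn]
    field_simp
  have hentSlope : ∑ i ∈ Finset.range n, entropyFn (gridSlope g n i) =
      ∑ i ∈ Finset.range n, entropyFn (p i) :=
    Finset.sum_congr rfl fun i hi => by rw [hslope i hi]
  refine ⟨g, hg, ?_⟩
  have hcongr : discreteFunctional ρ (β / n ^ 2) n p =
      discreteFunctional ρ (β / n ^ 2) n (gridSlope g n) := by
    have htail : ∀ k, tailSum (Finset.range n) p k = tailSum (Finset.range n) (gridSlope g n) k :=
      fun k => Finset.sum_congr rfl fun i hi => (hslope i (Finset.mem_filter.1 hi).1).symm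
    simp_rw [discreteFunctional, htail]
    rw [Finset.sum_congr rfl hslope, hentSlope]
  have h1 := (riemann_sum_bounds (admissiblePaths.antitoneOn_sq hg) hn).1
  have h2 := mul_le_mul_of_nonneg_left h1 hβ
  rw [hcongr, discreteFunctional_gridSlope hg.2.1 hn, pathFunctional, hentSlope]
  linarith

/-! ### Error terms and the sandwich -/

theorem natSqrt_succ_sq_le {n : ℕ} (hn : 0 < n) : ((Nat.sqrt n : ℝ) + 1) ^ 2 ≤ 4 * n := by
  have h1 : Nat.sqrt n ^ 2 ≤ n := Nat.sqrt_le' n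
  have h2 : 1 ≤ Nat.sqrt n := Nat.sqrt_pos.2 hn
  have h1' : (Nat.sqrt n : ℝ) ^ 2 ≤ n := by exact_mod_cast h1
  have h2' : (1 : ℝ) ≤ Nat.sqrt n := by exact_mod_cast h2
  nlinarith

theorem tendsto_natSqrt_mul_log_div :
    Tendsto (fun n : ℕ => ((Nat.sqrt n : ℝ) + 1) * Real.log (n + 1) / n) atTop (𝓝 0) := by
  have hlog : Tendsto (fun x : ℝ => 4 * (Real.log x / x ^ (1 / 2 : ℝ))) atTop (𝓝 0) := by
    simpa using (isLittleO_log_rpow_atTop (by norm_num : (0 : ℝ) < 1 / 2)).tendsto_div_nhds_zero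
      |>.const_mul 4
  refine squeeze_zero' (Eventually.of_forall fun n => ?_) ?_
    (hlog.comp (tendsto_atTop_add_const_right atTop 1 tendsto_natCast_atTop_atTop))
  · have : 0 ≤ Real.log ((n : ℝ) + 1) := Real.log_nonneg (by simp)
    positivity
  · filter_upwards [eventually_gt_atTop 0] with n hn
    have hn' : (1 : ℝ) ≤ n := by exact_mod_cast hn
    have hlog0 : 0 ≤ Real.log ((n : ℝ) + 1) := Real.log_nonneg (by simp)
    have hsqrt : ((Nat.sqrt n : ℝ) + 1) * √((n : ℝ) + 1) ≤ 4 * n := by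
      refine abs_le_of_sq_le_sq' ?_ (by positivity) |>.2
      rw [mul_pow, Real.sq_sqrt (by positivity)]
      nlinarith [natSqrt_succ_sq_le hn]
    simp only [Function.comp_apply]
    rw [← Real.sqrt_eq_rpow, ← mul_div_assoc, div_le_div_iff₀ (by positivity) (by positivity)]
    nlinarith

theorem exp_mul_pathFunctional_le_partitionSum {ρ β : ℝ} (hρ : 0 < ρ) (hβ : 0 ≤ β) {n : ℕ}
    (hn : 0 < n) {g : ℝ → ℝ} (hg : g ∈ admissiblePaths) :
    Real.exp (n * pathFunctional ρ β g - β) ≤ partitionSum ρ (β / n ^ 2) n := by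
  refine le_trans (Real.exp_le_exp.2 ?_) (exp_discreteFunctional_le_partitionSum hρ
    (by positivity) n fun i hi => gridSlope_mem hg hi)
  linarith [mul_pathFunctional_le hg hn hβ ρ]

/-- The lower bound at n = 1 already bounds every path, through y + 1 ≤ e^y. -/
theorem bddAbove_pathFunctional {ρ β : ℝ} (hρ : 0 < ρ) (hβ : 0 ≤ β) :
    BddAbove (pathFunctional ρ β '' admissiblePaths) := by
  refine ⟨partitionSum ρ (β / (1 : ℕ) ^ 2) 1 + β, ?_⟩
  rintro _ ⟨g, hg, rfl⟩
  have h1 := exp_mul_pathFunctional_le_partitionSum hρ hβ one_pos hg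
  have h2 := Real.add_one_le_exp ((1 : ℕ) * pathFunctional ρ β g - β)
  rw [Nat.cast_one, one_mul] at h1 h2
  push_cast
  linarith

theorem partitionSum_le_exp_sSup {ρ β : ℝ} (hρ : 0 < ρ) (hβ : 0 ≤ β) {n : ℕ} (hn : 0 < n) :
    partitionSum ρ (β / n ^ 2) n ≤ Real.exp (n * sSup (pathFunctional ρ β '' admissiblePaths)
      + 4 * β + (Nat.sqrt n + 1) * Real.log (n + 1)) := by
  have hn' : (0 : ℝ) < n := Nat.cast_pos.2 hn
  -- Taking L and m both ⌊√n⌋ + 1 keeps the rounding cost (β/n²)·n·L² below 4β and the number of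
  -- profiles subexponential.
  have h := partitionSum_le (ρ := ρ) (b := β / n ^ 2) hρ (by positivity) (n := n)
    (m := Nat.sqrt n + 1) (L := Nat.sqrt n + 1) (Nat.succ_pos _)
    (fun k hk => (Nat.div_lt_iff_lt_mul (Nat.succ_pos _)).2 (hk.trans (Nat.lt_succ_sqrt n)))
    (M := n * sSup (pathFunctional ρ β '' admissiblePaths)) fun p hp => by
      obtain ⟨g, hg, hle⟩ := exists_admissiblePath_discreteFunctional_le hp hn hβ ρ
      exact hle.trans (mul_le_mul_of_nonneg_left
        (le_csSup (bddAbove_pathFunctional hρ hβ) ⟨g, hg, rfl⟩) hn'.le)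
  refine h.trans ?_
  have hpow : ((n : ℝ) + 1) ^ (Nat.sqrt n + 1) =
      Real.exp ((Nat.sqrt n + 1) * Real.log (n + 1)) := by
    have := Real.exp_nat_mul (Real.log ((n : ℝ) + 1)) (Nat.sqrt n + 1)
    rw [Real.exp_log (by positivity)] at this
    rw [← this]
    push_cast
    rfl
  rw [hpow, ← Real.exp_add, ← Real.exp_add, Real.exp_le_exp]
  have : β / (n : ℝ) ^ 2 * (n * ((Nat.sqrt n + 1 : ℕ) : ℝ) ^ 2) ≤ 4 * β := by
    have h4 := mul_le_mul_of_nonneg_left (natSqrt_succ_sq_le hn) hβ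
    push_cast
    rw [div_mul_eq_mul_div, div_le_iff₀ (by positivity)]
    nlinarith
  linarith

/-- For S inside `range n`, ∑_{i∈S} i lies between 0 and n², so with b = β/n² the linear term costs
at most e^{-β}. -/
theorem integral_process_bounds {Ω : Type*} [MeasurableSpace Ω] {P : Measure Ω}
    {W : ℝ≥0 → Ω → ℝ} (hW : IsPreBrownianReal W P) {x₀ ρ σ β : ℝ} (hx₀ : 0 < x₀) (hρ : 0 < ρ)
    (hβ : 0 ≤ β) {τ : ℝ≥0} (hτ : 0 < τ) {n : ℕ} (hn : 0 < n) (h : σ ^ 2 * τ * (n : ℝ) ^ 2 / 2 = β) :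
    x₀ * (Real.exp (-β) * partitionSum ρ (β / n ^ 2) n) ≤ ∫ ω, process x₀ ρ σ τ W n ω ∂P ∧
    ∫ ω, process x₀ ρ σ τ W n ω ∂P ≤ x₀ * partitionSum ρ (β / n ^ 2) n := by
  have hn' : (0 : ℝ) < n := Nat.cast_pos.2 hn
  have hb : σ ^ 2 * τ / 2 = β / n ^ 2 := by
    rw [eq_div_iff (by positivity)]
    linarith
  have hb0 : 0 ≤ β / (n : ℝ) ^ 2 := by positivity
  rw [integral_process hW x₀ ρ σ hτ, hb, partitionSum, Finset.mul_sum (Finset.powerset _)]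
  constructor
  · refine mul_le_mul_of_nonneg_left (Finset.sum_le_sum fun s hs => ?_) hx₀.le
    rw [mul_left_comm, ← Real.exp_add]
    gcongr
    have hsum : ∑ i ∈ s, (i : ℝ) ≤ (n : ℝ) ^ 2 := by
      have hsub := Finset.mem_powerset.1 hs
      calc ∑ i ∈ s, (i : ℝ) ≤ ∑ i ∈ Finset.range n, (i : ℝ) :=
            Finset.sum_le_sum_of_subset_of_nonneg hsub fun _ _ _ => Nat.cast_nonneg _
        _ ≤ ∑ _i ∈ Finset.range n, (n : ℝ) :=
            Finset.sum_le_sum fun i hi => Nat.cast_le.2 (Finset.mem_range.1 hi).le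
        _ = (n : ℝ) ^ 2 := by simp [sq]
    have := mul_le_mul_of_nonneg_left hsum hb0
    rw [div_mul_cancel₀ _ (by positivity)] at this
    linarith
  · gcongr with s hs
    have : 0 ≤ ∑ i ∈ s, (i : ℝ) := by positivity
    linarith

theorem zero_mem_admissiblePaths : (fun _ => 0) ∈ admissiblePaths :=
  ⟨fun _ _ => ⟨le_rfl, zero_le_one⟩, rfl,
    (LipschitzWith.const (0 : ℝ)).lipschitzOnWith.absolutelyContinuousOnInterval,
    ae_of_all _ fun x => by simp⟩

end LinearRecursion

theorem mainTheorem1 {Ω : Type*} [MeasurableSpace Ω] (P : Measure Ω) [IsProbabilityMeasure P]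
    (W : ℝ≥0 → Ω → ℝ) (hW : IsBrownianReal W P)
    (x₀ ρ β : ℝ) (hx₀ : 0 < x₀) (hρ : 0 < ρ)
    (σ : ℕ → ℝ) (τ : ℕ → ℝ≥0) (hσ : ∀ n, 0 < σ n) (hτ : ∀ n, 0 < τ n)
    (hβ : ∀ n : ℕ, 1 ≤ n → σ n ^ 2 * (τ n : ℝ) * (n : ℝ) ^ 2 / 2 = β) :
    (∀ n : ℕ, Integrable (LinearRecursion.process x₀ ρ (σ n) (τ n) W n) P) ∧
    ∃ lam : ℝ,
      Tendsto
        (fun n : ℕ => 1 / (n : ℝ) *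
          Real.log (∫ ω, LinearRecursion.process x₀ ρ (σ n) (τ n) W n ω ∂P))
        atTop (𝓝 lam) ∧
      IsLUB (LinearRecursion.pathFunctional ρ β '' LinearRecursion.admissiblePaths) lam := by
  open LinearRecursion in
  refine ⟨fun n => integrable_process hW.toIsPreBrownianReal x₀ ρ (σ n) (hτ n) n, ?_⟩
  have hβ0 : 0 ≤ β := by
    rw [← hβ 1 le_rfl]
    positivity
  have hne : (pathFunctional ρ β '' admissiblePaths).Nonempty :=
    ⟨_, _, zero_mem_admissiblePaths, rfl⟩
  have hbdd := bddAbove_pathFunctional hρ hβ0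
  set S := sSup (pathFunctional ρ β '' admissiblePaths) with hS
  refine ⟨S, ?_, isLUB_csSup hne hbdd⟩
  have hbounds := fun {n : ℕ} (hn : 0 < n) => integral_process_bounds hW.toIsPreBrownianReal hx₀ hρ
    hβ0 (hτ n) hn (hβ n hn)
  have hinv : Tendsto (fun n : ℕ => 1 / (n : ℝ)) atTop (𝓝 0) := tendsto_one_div_atTop_nhds_zero_nat
  -- One β comes from the linear term ∑ i, the other from the Riemann sum; neither depends on g, so
  -- the supremum may be taken at fixed n.
  have hlower : ∀ n : ℕ, 0 < n → S + (Real.log x₀ - 2 * β) * (1 / n) ≤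
      1 / (n : ℝ) * Real.log (∫ ω, process x₀ ρ (σ n) (τ n) W n ω ∂P) := by
    intro n hn
    have hn' : (0 : ℝ) < n := Nat.cast_pos.2 hn
    rw [← le_sub_iff_add_le]
    refine csSup_le hne ?_
    rintro _ ⟨g, hg, rfl⟩
    have h1 : x₀ * (Real.exp (-β) * Real.exp (n * pathFunctional ρ β g - β)) ≤ _ :=
      le_trans (by gcongr; exact exp_mul_pathFunctional_le_partitionSum hρ hβ0 hn hg)
        (hbounds hn).1
    have h2 := Real.log_le_log (by positivity) h1
    rw [← Real.exp_add, Real.log_mul hx₀.ne' (Real.exp_pos _).ne', Real.log_exp] at h2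
    have h3 := mul_le_mul_of_nonneg_left h2 (one_div_nonneg.2 hn'.le)
    have h4 : 1 / (n : ℝ) * (Real.log x₀ + (-β + (n * pathFunctional ρ β g - β))) =
        pathFunctional ρ β g + (Real.log x₀ - 2 * β) * (1 / n) := by
      field_simp
      ring
    linarith
  have hupper : ∀ n : ℕ, 0 < n →
      1 / (n : ℝ) * Real.log (∫ ω, process x₀ ρ (σ n) (τ n) W n ω ∂P) ≤
      S + (Real.log x₀ + 4 * β) * (1 / n) + (Nat.sqrt n + 1) * Real.log (n + 1) / n := by
    intro n hn
    have hn' : (0 : ℝ) < n := Nat.cast_pos.2 hn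
    have hpos : 0 < ∫ ω, process x₀ ρ (σ n) (τ n) W n ω ∂P := by
      refine lt_of_lt_of_le ?_ (hbounds hn).1
      have := (Real.exp_pos _).trans_le
        (exp_mul_pathFunctional_le_partitionSum hρ hβ0 hn zero_mem_admissiblePaths)
      positivity
    have h2 := Real.log_le_log hpos ((hbounds hn).2.trans
      (mul_le_mul_of_nonneg_left (partitionSum_le_exp_sSup hρ hβ0 hn) hx₀.le))
    rw [Real.log_mul hx₀.ne' (Real.exp_pos _).ne', Real.log_exp, ← hS] at h2
    refine (mul_le_mul_of_nonneg_left h2 (one_div_nonneg.2 hn'.le)).trans_eq ?_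
    field_simp
    ring
  refine tendsto_of_tendsto_of_tendsto_of_le_of_le' ?_ ?_
    (eventually_gt_atTop 0 |>.mono hlower) (eventually_gt_atTop 0 |>.mono hupper)
  · simpa using (hinv.const_mul (Real.log x₀ - 2 * β)).const_add S
  · simpa using ((hinv.const_mul (Real.log x₀ + 4 * β)).const_add S).add tendsto_natSqrt_mul_log_div
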